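/- Hurewicz's formula in degree 1. A topological space $X$ is called locally relatively 1-connected if each point of $X$ has a fundamental system of path-connected neighbourhoods $U$ such that every loop in $U$ is homotopic in $X$ to a constant path. For a group $G$, let $G_X$ be the constant sheaf on $X$ with stalk $G$ (its sections over an open set are the locally constant $G$-valued functions), and let $H^1(X;G_X)$ be the first non-abelian Čech cohomology set: the direct limit, over open coverings $(U_i)_{i\in I}$ of $X$ ordered by refinement, of the sets of 1-cocycles $(g_{ij})$, $g_{ij}\in\Gamma(U_i\cap U_j;G_X)$, $g_{ij}g_{jk}=g_{ik}$ on $U_i\cap U_j\cap U_k$, modulo the relation $g'_{ij}=\alpha_i g_{ij}\alpha_j^{-1}$ with $\alpha_i\in\Gamma(U_i;G_X)$. It is pointed by the class of the trivial cocycle. Let $X$ be a connected and locally relatively 1-connected topological space, let $x\in X$ and let $G$ be any group. Then there is an isomorphism of pointed sets $$H^1(X;G_X)\overset{\sim}{\longrightarrow}\operatorname{Hom}(\pi_1(X,x),G)/G,$$ where $G$ acts on $\operatorname{Hom}(\pi_1(X,x),G)$ by conjugation, $(g\cdot\varphi)(\gamma)=g\varphi(\gamma)g^{-1}$, and the right-hand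 side is pointed by the orbit of the trivial homomorphism. More precisely, the isomorphism is given by monodromy. Here the product in $\pi_1(X,x)$ is that of the homotopy groupoid in which composition is opposite to concatenation of paths, so that $[\gamma][\delta]$ is the class of $\delta$ followed by $\gamma$. Let $(g_{ij})$ be a cocycle on a covering $(U_i)_{i\in I}$ and let $i_0\in I$ with $x\in U_{i_0}$. Then there is a homomorphism $\rho\colon\pi_1(X,x)\to G$ such that for each loop $\gamma\colon[0,1]\to X$ at $x$ there are locally constant functions $h_i\colon\gamma^{-1}(U_i)\to G$ with $h_i(t)=g_{ij}(\gamma(t))h_j(t)$ whenever $\gamma(t)\in U_i\cap U_j$, with $h_{i_0}(0)=1$ and $h_{i_0}(1)=\rho([\gamma])$; and the isomorphism sends the class of $(g_{ij})$ to the orbit of $\rho$. -/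

import Mathlib

open CategoryTheory Topology TopologicalSpace Opposite

universe u v w

noncomputable section

/-- A topological space is locally relatively 1-connected if each point has a fundamental system of
path-connected (not necessarily open) neighbourhoods `U` such that each loop contained in `U` is
homotopic in the whole space, with fixed end points, to a constant path. -/
class LocallyRelativelyOneConnectedSpace (X : Type u) [TopologicalSpace X] : Prop where
  exists_nhds : ∀ x : X, ∀ N ∈ 𝓝 x, ∃ U ∈ 𝓝 x, U ⊆ N ∧ IsPathConnected U ∧
    ∀ (y : X) (γ : Path y y), (∀ t, γ t ∈ U) → γ.Homotopic (Path.refl y)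

/-- The constant sheaf `G_X` with stalk the group `G`: its sections over an open subset `U` are
the locally constant functions `U → G`, with pointwise multiplication. -/
def constantGroupSheaf (X : Type u) [TopologicalSpace X] (G : Type v) [Group G] :
    (Opens X)ᵒᵖ ⥤ GrpCat.{max u v} where
  obj U := GrpCat.of (LocallyConstant U.unop G)
  map {U V} f := GrpCat.ofHom (LocallyConstant.comapMonoidHom
    (⟨fun y => ⟨y.1, leOfHom f.unop y.2⟩, by fun_prop⟩ : C(V.unop, U.unop)))

/-- An open covering `(U_i)_{i ∈ I}` of `X`. -/
structure OpenCovering (X : Type u) [TopologicalSpace X] where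
  I : Type u
  U : I → Opens X
  covers : ∀ x : X, ∃ i, x ∈ U i

/-- The covering of `X` by the single open subset `X`. -/
def OpenCovering.trivial (X : Type u) [TopologicalSpace X] : OpenCovering X where
  I := PUnit
  U _ := ⊤
  covers _ := ⟨PUnit.unit, Set.mem_univ _⟩

/-- A refinement map exhibiting the covering `W` as a refinement of the covering `V`. -/
structure OpenCovering.Refinement {X : Type u} [TopologicalSpace X] (W V : OpenCovering X) where
  map : W.I → V.I
  le : ∀ i, W.U i ≤ V.U (map i)

section Cech

variable {X : Type u} [TopologicalSpace X]

/-- A Čech 1-cocycle of `X` with values in a sheaf of (not necessarily commutative) groups: an open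
covering `(U_i)` and sections `g_ij` over `U_i ∩ U_j` with `g_ij * g_jk = g_ik`. -/
structure CechOneCocycle (F : (Opens X)ᵒᵖ ⥤ GrpCat.{w}) where
  cover : OpenCovering X
  cocycle : PresheafOfGroups.OneCocycle F cover.U

namespace CechOneCocycle

variable {F : (Opens X)ᵒᵖ ⥤ GrpCat.{w}}

/-- The trivial cocycle; its class is the base point of `H¹(X; F)`. -/
def trivial (F : (Opens X)ᵒᵖ ⥤ GrpCat.{w}) : CechOneCocycle F where
  cover := OpenCovering.trivial X
  cocycle := 1

/-- The restriction of a cocycle to a finer covering. -/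
def restrict (c : CechOneCocycle F) {W : OpenCovering X} (r : W.Refinement c.cover) :
    PresheafOfGroups.OneCocycle F W.U where
  ev i j _ a b := c.cocycle.ev (r.map i) (r.map j) (a ≫ homOfLE (r.le i)) (b ≫ homOfLE (r.le j))
  ev_precomp i j _ _ φ a b := by simp
  ev_trans i j k _ a b d := c.cocycle.ev_trans _ _ _ _ _ _

/-- Two cocycles are equivalent if they become cohomologous on a common refinement of their
coverings. -/
def IsEquivalent (c c' : CechOneCocycle F) : Prop :=
  ∃ (W : OpenCovering X) (r : W.Refinement c.cover) (r' : W.Refinement c'.cover),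
    (c.restrict r).IsCohomologous (c'.restrict r')

end CechOneCocycle

/-- The first non-abelian Čech cohomology set `H¹(X; F)`: the direct limit, over all open coverings
of `X` ordered by refinement, of the sets of cohomology classes of 1-cocycles. -/
def CechH1 (F : (Opens X)ᵒᵖ ⥤ GrpCat.{w}) : Type _ :=
  Quot (CechOneCocycle.IsEquivalent (F := F))

/-- The class in `H¹(X; F)` of a cocycle. -/
def CechOneCocycle.toH1 {F : (Opens X)ᵒᵖ ⥤ GrpCat.{w}} (c : CechOneCocycle F) : CechH1 F :=
  Quot.mk _ c

namespace CechOneCocycle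

variable {G : Type v} [Group G]

/-- The value `g_ij(y) ∈ G` at `y ∈ U_i ∩ U_j` of a cocycle `(g_ij)` with values in the constant
sheaf `G_X`. -/
def val (c : CechOneCocycle (constantGroupSheaf X G)) (i j : c.cover.I) (y : X)
    (hi : y ∈ c.cover.U i) (hj : y ∈ c.cover.U j) : G :=
  let s : LocallyConstant ↥(c.cover.U i ⊓ c.cover.U j) G :=
    c.cocycle.ev i j (homOfLE inf_le_left) (homOfLE inf_le_right)
  s ⟨y, hi, hj⟩

/-- A global section over the unit interval of the pull-back along the path `γ` of the right
`G_X`-torsor with transition functions `(g_ij)`: locally constant functions `h_i : γ⁻¹(U_i) → G`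
such that `h_i = (g_ij ∘ γ) * h_j` on `γ⁻¹(U_i ∩ U_j)`. -/
structure SectionAlong (c : CechOneCocycle (constantGroupSheaf X G)) {x y : X}
    (γ : Path x y) where
  h : ∀ i : c.cover.I, LocallyConstant {t : unitInterval // γ t ∈ c.cover.U i} G
  compat : ∀ (i j : c.cover.I) (t : unitInterval) (hi : γ t ∈ c.cover.U i)
    (hj : γ t ∈ c.cover.U j), h i ⟨t, hi⟩ = c.val i j (γ t) hi hj * h j ⟨t, hj⟩

/-- `ρ` is the monodromy representation at the base point `x` of the torsor with transition
functions `(g_ij)`, the fibre at `x` being identified with `G` by means of the index `i` with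
`x ∈ U_i`. That is: for each loop `γ` at `x`, the section along `γ` of the torsor which starts at
`1` ends at `ρ(γ)`. -/
def IsMonodromy (c : CechOneCocycle (constantGroupSheaf X G)) {x : X} (i : c.cover.I)
    (hi : x ∈ c.cover.U i) (ρ : FundamentalGroup X x →* G) : Prop :=
  ∀ γ : Path x x, ∃ s : c.SectionAlong γ,
    s.h i ⟨0, γ.source.symm ▸ hi⟩ = 1 ∧
    s.h i ⟨1, γ.target.symm ▸ hi⟩ = ρ (FundamentalGroup.fromPath (Path.Homotopic.Quotient.mk γ))

end CechOneCocycle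

end Cech

/-- Two homomorphisms `φ, ψ : P → G` are conjugate if `φ = ad(g) ∘ ψ` for some `g ∈ G`, where
`ad(g)(h) = g * h * g⁻¹`. -/
def conjSetoid (P : Type u) [Group P] (G : Type v) [Group G] : Setoid (P →* G) where
  r φ ψ := ∃ g : G, φ = (MulAut.conj g).toMonoidHom.comp ψ
  iseqv :=
    { refl := fun φ => ⟨1, by ext; simp⟩
      symm := by
        rintro φ ψ ⟨g, rfl⟩
        exact ⟨g⁻¹, by ext; simp [mul_assoc]⟩
      trans := by
        rintro φ ψ χ ⟨g, rfl⟩ ⟨k, rfl⟩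
        exact ⟨g * k, by ext; simp [mul_assoc]⟩ }

/-- The orbit set `Hom(P, G)/G` for the action of `G` by conjugation. -/
def HomModConj (P : Type u) [Group P] (G : Type v) [Group G] : Type (max u v) :=
  Quotient (conjSetoid P G)

/-- The orbit of a homomorphism. The orbit of the trivial homomorphism is the base point of
`Hom(P, G)/G`. -/
def HomModConj.mk {P : Type u} [Group P] {G : Type v} [Group G] (φ : P →* G) : HomModConj P G :=
  Quotient.mk (conjSetoid P G) φ

end

/-! A cocycle `(g_ij)` describes a `G`-torsor over `X` that is locally constant, that is, a covering
space with fibre `G` on which `G` acts by right multiplication. Paths lift uniquely to a covering,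
and the end of the lift depends only on the homotopy class. Read in the coordinates `i` and `j` at
the two end points, lifting is left multiplication by an element of `G`, the transport; for loops at
`x` it gives the monodromy homomorphism.

Well defined: an equivalence of cocycles carries sections along `γ` to sections along `γ`, and two
sections along one path differ by a constant on the right because the interval is connected. The
monodromies are therefore conjugate (`IsEquivalent.monodromy_conj`).

Injective: if the monodromies are conjugate by `g`, an isomorphism of torsors at `y` is obtained by
transporting back to `x`, applying `g`, and transporting to `y` in the other torsor. Conjugacy makes
this independent of the path, and local path-connectedness makes it locally constant
(`isEquivalent_of_monodromy_conj`).

Surjective: near each point, path classes from `x` can be chosen compatibly with short paths,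
because short loops die in `X`. On an overlap, two such choices differ by a loop at `x`, and
applying `ρ` to it gives a cocycle with monodromy conjugate to `ρ` (`exists_monodromy_conj`). -/

theorem LocallyConstant.eventually_subtype {Y : Type*} [TopologicalSpace Y] {S : Type*}
    {p : Y → Prop} (hp : IsOpen {y | p y}) (f : LocallyConstant {y // p y} S) (y : Y) (hy : p y) :
    ∀ᶠ z in 𝓝 y, ∃ hz : p z, f ⟨z, hz⟩ = f ⟨y, hy⟩ := by
  have h := f.isLocallyConstant.eventually_eq ⟨y, hy⟩
  rw [nhds_subtype_eq_comap, Filter.eventually_comap] at h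
  filter_upwards [h, hp.mem_nhds hy] with z hz hz'
  exact ⟨hz', hz ⟨z, hz'⟩ rfl⟩

theorem IsLocallyConstant.of_eventually_subtype {Y : Type*} [TopologicalSpace Y] {S : Type*}
    {p : Y → Prop} (f : {y // p y} → S)
    (h : ∀ y hy, ∀ᶠ z in 𝓝 y, ∀ hz : p z, f ⟨z, hz⟩ = f ⟨y, hy⟩) : IsLocallyConstant f := by
  rw [IsLocallyConstant.iff_eventually_eq]
  rintro ⟨y, hy⟩
  rw [nhds_subtype_eq_comap, Filter.eventually_comap]
  filter_upwards [h y hy] with z hz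
  rintro ⟨w, hw⟩ rfl
  exact hz hw

/-! ### Cocycles and their equivalence in terms of values at points -/

namespace CechOneCocycle

variable {X : Type u} [TopologicalSpace X] {G : Type v} [Group G]

/-- Compatibility with restriction reduces a section over any test open set to the one over the full
overlap, so a cocycle is determined by its functions `val`. -/
theorem ev_apply (c : CechOneCocycle (constantGroupSheaf X G)) (i j : c.cover.I) {T : Opens X}
    (a : T ⟶ c.cover.U i) (b : T ⟶ c.cover.U j) (y : T) :
    (show LocallyConstant T G from c.cocycle.ev i j a b) y =
      c.val i j y (leOfHom a y.2) (leOfHom b y.2) := by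
  have h := c.cocycle.ev_precomp i j
    (homOfLE (le_inf (leOfHom a) (leOfHom b)) : T ⟶ c.cover.U i ⊓ c.cover.U j)
    (homOfLE inf_le_left) (homOfLE inf_le_right)
  have h' : c.cocycle.ev i j a b = _ := h.symm
  rw [h']
  rfl

theorem val_mul (c : CechOneCocycle (constantGroupSheaf X G)) (i j k : c.cover.I) (y : X)
    (hi : y ∈ c.cover.U i) (hj : y ∈ c.cover.U j) (hk : y ∈ c.cover.U k) :
    c.val i j y hi hj * c.val j k y hj hk = c.val i k y hi hk := by
  let T : Opens X := c.cover.U i ⊓ c.cover.U j ⊓ c.cover.U k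
  let a : T ⟶ c.cover.U i := homOfLE (inf_le_left.trans inf_le_left)
  let b : T ⟶ c.cover.U j := homOfLE (inf_le_left.trans inf_le_right)
  let d : T ⟶ c.cover.U k := homOfLE inf_le_right
  have h := c.cocycle.ev_trans i j k a b d
  have h1 := LocallyConstant.congr_fun (Y := G) (X := T) h ⟨y, ⟨hi, hj⟩, hk⟩
  rw [← c.ev_apply i k a d ⟨y, ⟨hi, hj⟩, hk⟩, ← c.ev_apply i j a b ⟨y, ⟨hi, hj⟩, hk⟩,
    ← c.ev_apply j k b d ⟨y, ⟨hi, hj⟩, hk⟩]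
  exact h1

@[simp]
theorem val_self (c : CechOneCocycle (constantGroupSheaf X G)) (i : c.cover.I) (y : X)
    (hi hi' : y ∈ c.cover.U i) : c.val i i y hi hi' = 1 := by
  simpa using c.val_mul i i i y hi hi hi

theorem val_inv (c : CechOneCocycle (constantGroupSheaf X G)) (i j : c.cover.I) (y : X)
    (hi : y ∈ c.cover.U i) (hj : y ∈ c.cover.U j) :
    (c.val i j y hi hj)⁻¹ = c.val j i y hj hi := by
  rw [inv_eq_iff_mul_eq_one, val_mul, val_self]

theorem eventually_val_eq (c : CechOneCocycle (constantGroupSheaf X G)) (i j : c.cover.I) (y : X)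
    (hi : y ∈ c.cover.U i) (hj : y ∈ c.cover.U j) :
    ∀ᶠ z in 𝓝 y, ∀ (hi' : z ∈ c.cover.U i) (hj' : z ∈ c.cover.U j),
      c.val i j z hi' hj' = c.val i j y hi hj := by
  let s : LocallyConstant ↥(c.cover.U i ⊓ c.cover.U j) G :=
    c.cocycle.ev i j (homOfLE inf_le_left) (homOfLE inf_le_right)
  filter_upwards [LocallyConstant.eventually_subtype
    (c.cover.U i ⊓ c.cover.U j).isOpen s y ⟨hi, hj⟩] with z hz hi' hj'
  exact hz.2

/-- The relation `A_k g_kl = g'_kl A_l` on a common refinement of the coverings of `c` and `c'`,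
for values of sections. -/
def Intertwines (c c' : CechOneCocycle (constantGroupSheaf X G)) {W : OpenCovering X}
    (r : W.Refinement c.cover) (r' : W.Refinement c'.cover)
    (A : ∀ k, LocallyConstant (W.U k) G) : Prop :=
  ∀ k l y (hk : y ∈ W.U k) (hl : y ∈ W.U l),
    A k ⟨y, hk⟩ * c.val (r.map k) (r.map l) y (r.le k hk) (r.le l hl) =
      c'.val (r'.map k) (r'.map l) y (r'.le k hk) (r'.le l hl) * A l ⟨y, hl⟩

theorem isEquivalent_iff {c c' : CechOneCocycle (constantGroupSheaf X G)} :
    c.IsEquivalent c' ↔ ∃ (W : OpenCovering X) (r : W.Refinement c.cover)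
      (r' : W.Refinement c'.cover) (A : ∀ k, LocallyConstant (W.U k) G),
      c.Intertwines c' r r' A := by
  constructor
  · rintro ⟨W, r, r', A, hA⟩
    refine ⟨W, r, r', A, fun k l y hk hl => ?_⟩
    let T : Opens X := W.U k ⊓ W.U l
    let a : T ⟶ W.U k := homOfLE inf_le_left
    let b : T ⟶ W.U l := homOfLE inf_le_right
    have h := LocallyConstant.congr_fun (Y := G) (X := T) (hA k l a b) ⟨y, hk, hl⟩
    rw [← c.ev_apply _ _ (a ≫ homOfLE (r.le k)) (b ≫ homOfLE (r.le l)) ⟨y, hk, hl⟩,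
      ← c'.ev_apply _ _ (a ≫ homOfLE (r'.le k)) (b ≫ homOfLE (r'.le l)) ⟨y, hk, hl⟩]
    exact h
  · rintro ⟨W, r, r', A, hA⟩
    refine ⟨W, r, r', A, fun k l T a b => ?_⟩
    refine LocallyConstant.ext (X := T) (Y := G) fun y => ?_
    have h := hA k l y (leOfHom a y.2) (leOfHom b y.2)
    rw [← c.ev_apply _ _ (a ≫ homOfLE (r.le k)) (b ≫ homOfLE (r.le l)) y,
      ← c'.ev_apply _ _ (a ≫ homOfLE (r'.le k)) (b ≫ homOfLE (r'.le l)) y] at h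
    exact h

theorem intertwines_refl (c : CechOneCocycle (constantGroupSheaf X G)) :
    c.Intertwines c ⟨id, fun _ => le_rfl⟩ ⟨id, fun _ => le_rfl⟩ 1 := by
  intro k l y hk hl
  simp

theorem IsEquivalent.refl (c : CechOneCocycle (constantGroupSheaf X G)) : c.IsEquivalent c :=
  isEquivalent_iff.2 ⟨_, _, _, _, c.intertwines_refl⟩

/-- The quotient of the two sides, read in coordinates `k`, does not depend on `k` by the cocycle
relations. It is thus a locally constant function on the connected unit interval. -/
theorem Intertwines.exists_eq_mul {c c' : CechOneCocycle (constantGroupSheaf X G)}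
    {W : OpenCovering X} {r : W.Refinement c.cover} {r' : W.Refinement c'.cover}
    {A : ∀ k, LocallyConstant (W.U k) G} (hA : c.Intertwines c' r r' A) {x y : X} {γ : Path x y}
    (s : c.SectionAlong γ) (s' : c'.SectionAlong γ) :
    ∃ g : G, ∀ t k (hk : γ t ∈ W.U k),
      A k ⟨γ t, hk⟩ * s.h (r.map k) ⟨t, r.le k hk⟩ = s'.h (r'.map k) ⟨t, r'.le k hk⟩ * g := by
  let κ : unitInterval → W.I := fun t => (W.covers (γ t)).choose
  have hκ : ∀ t, γ t ∈ W.U (κ t) := fun t => (W.covers (γ t)).choose_spec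
  let f : ∀ t k, γ t ∈ W.U k → G := fun t k hk =>
    (s'.h (r'.map k) ⟨t, r'.le k hk⟩)⁻¹ * (A k ⟨γ t, hk⟩ * s.h (r.map k) ⟨t, r.le k hk⟩)
  have hf : ∀ t k l (hk : γ t ∈ W.U k) (hl : γ t ∈ W.U l), f t k hk = f t l hl := by
    intro t k l hk hl
    simp only [f]
    rw [s.compat _ (r.map l) t _ (r.le l hl), s'.compat _ (r'.map l) t _ (r'.le l hl),
      ← mul_assoc (A k _), hA k l _ hk hl]
    group
  have hloc : IsLocallyConstant fun t => f t (κ t) (hκ t) := by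
    rw [IsLocallyConstant.iff_eventually_eq]
    intro t
    have hop : ∀ V : Opens X, IsOpen {t | γ t ∈ V} := fun V => V.isOpen.preimage γ.continuous
    filter_upwards [
      LocallyConstant.eventually_subtype (hop _) (s.h (r.map (κ t))) t (r.le _ (hκ t)),
      LocallyConstant.eventually_subtype (hop _) (s'.h (r'.map (κ t))) t (r'.le _ (hκ t)),
      γ.continuous.continuousAt.eventually
        (LocallyConstant.eventually_subtype (W.U (κ t)).isOpen (A (κ t)) (γ t) (hκ t))]
    rintro t' ⟨h1, e1⟩ ⟨h2, e2⟩ ⟨h3, e3⟩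
    rw [hf t' (κ t') (κ t) (hκ t') h3]
    simp only [f]
    rw [e1, e2]
    congr 2
  refine ⟨f 0 (κ 0) (hκ 0), fun t k hk => ?_⟩
  rw [hloc.apply_eq_of_preconnectedSpace 0 t, hf t (κ t) k (hκ t) hk]
  simp [f]

/-- Two sections along the same path differ by right multiplication by a constant. -/
theorem SectionAlong.exists_eq_mul {c : CechOneCocycle (constantGroupSheaf X G)} {x y : X}
    {γ : Path x y} (s s' : c.SectionAlong γ) :
    ∃ g : G, ∀ t k (hk : γ t ∈ c.cover.U k), s.h k ⟨t, hk⟩ = s'.h k ⟨t, hk⟩ * g := by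
  obtain ⟨g, hg⟩ := c.intertwines_refl.exists_eq_mul s s'
  exact ⟨g, fun t k hk => by simpa using hg t k hk⟩

/-! ### The covering space of a cocycle and path lifting -/

open Classical in
/-- The bundle with fibre `G` whose changes of coordinates are left multiplications by the
values of the cocycle. -/
noncomputable def bundleCore (c : CechOneCocycle (constantGroupSheaf X G)) [TopologicalSpace G]
    [DiscreteTopology G] : FiberBundleCore c.cover.I X G where
  baseSet i := c.cover.U i
  isOpen_baseSet i := (c.cover.U i).isOpen
  indexAt y := (c.cover.covers y).choose
  mem_baseSet_at y := (c.cover.covers y).choose_spec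
  -- The indices are swapped because sections satisfy `h_j = g_ji * h_i`. The value off the overlap
  -- is irrelevant.
  coordChange i j y a := if h : y ∈ c.cover.U i ∧ y ∈ c.cover.U j then c.val j i y h.2 h.1 * a
    else a
  coordChange_self i y hy a := by
    have hy' : y ∈ c.cover.U i := hy
    simp [hy']
  continuousOn_coordChange i j := by
    rintro ⟨y, a⟩ ⟨⟨hi, hj⟩, -⟩
    refine ContinuousAt.continuousWithinAt ?_
    refine (continuousAt_const (y := c.val j i y hj hi * a)).congr ?_
    rw [nhds_prod_eq]
    filter_upwards [Filter.prod_mem_prod (Filter.inter_mem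
      (((c.cover.U i).isOpen.inter (c.cover.U j).isOpen).mem_nhds ⟨hi, hj⟩)
      (c.eventually_val_eq j i y hj hi)) ((discreteTopology_iff_singleton_mem_nhds.1 ‹_›) a)]
    rintro ⟨z, b⟩ ⟨⟨⟨hzi, hzj⟩, hz⟩, hb⟩
    obtain rfl : b = a := hb
    have hzi' : z ∈ c.cover.U i := hzi
    have hzj' : z ∈ c.cover.U j := hzj
    simp only [hzi', hzj', and_self, dite_true]
    rw [hz hzj' hzi']
  coordChange_comp i j k y hy a := by
    obtain ⟨⟨hi, hj⟩, hk⟩ := hy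
    have hi' : y ∈ c.cover.U i := hi
    have hj' : y ∈ c.cover.U j := hj
    have hk' : y ∈ c.cover.U k := hk
    simp only [hi', hj', hk', and_self, dite_true]
    rw [← mul_assoc, val_mul]

theorem bundleCore_coordChange (c : CechOneCocycle (constantGroupSheaf X G)) [TopologicalSpace G]
    [DiscreteTopology G] (i j : c.cover.I) (y : X) (hi : y ∈ c.cover.U i) (hj : y ∈ c.cover.U j)
    (a : G) : c.bundleCore.coordChange i j y a = c.val j i y hj hi * a :=
  dif_pos ⟨hi, hj⟩

theorem isCoveringMap_bundleCore_proj (c : CechOneCocycle (constantGroupSheaf X G))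
    [TopologicalSpace G] [DiscreteTopology G] : IsCoveringMap c.bundleCore.proj :=
  IsFiberBundle.isCoveringMap fun y =>
    ⟨c.bundleCore.localTrivAt y, c.bundleCore.mem_baseSet_at y⟩

/-- The section along a path given by a lift of the path to the total space of the bundle. -/
noncomputable def sectionOfLift (c : CechOneCocycle (constantGroupSheaf X G)) [TopologicalSpace G]
    [DiscreteTopology G] {x y : X} (γ : Path x y) (Γ : C(unitInterval, c.bundleCore.TotalSpace))
    (hΓ : ∀ t, (Γ t).proj = γ t) : c.SectionAlong γ where
  h i :=
    { toFun := fun t => (c.bundleCore.localTriv i (Γ t.1)).2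
      isLocallyConstant := by
        rw [IsLocallyConstant.iff_continuous]
        refine continuous_snd.comp ((c.bundleCore.localTriv i).continuousOn.comp_continuous
          (Γ.continuous.comp continuous_subtype_val) fun t => ?_)
        rw [FiberBundleCore.mem_localTriv_source]
        show (Γ t.1).proj ∈ c.cover.U i
        rw [hΓ]
        exact t.2 }
  compat i j t hi hj := by
    show c.bundleCore.coordChange _ i (Γ t).proj (Γ t).2 =
      _ * c.bundleCore.coordChange _ j (Γ t).proj (Γ t).2
    have h := c.bundleCore.coordChange_comp (c.bundleCore.indexAt (Γ t).proj) j i (Γ t).proj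
      ⟨⟨c.bundleCore.mem_baseSet_at _, by rw [hΓ]; exact hj⟩, by rw [hΓ]; exact hi⟩ (Γ t).2
    rw [← h, bundleCore_coordChange c j i _ (by rw [hΓ]; exact hj) (by rw [hΓ]; exact hi)]
    congr 1
    congr 1
    exact hΓ t

/-- With `G` discrete the bundle is a covering map, and the lift of `γ` starting at the point with
coordinate `a` is the required section. -/
theorem exists_sectionAlong (c : CechOneCocycle (constantGroupSheaf X G)) {x y : X} (γ : Path x y)
    (i : c.cover.I) (hi : γ 0 ∈ c.cover.U i) (a : G) :
    ∃ s : c.SectionAlong γ, s.h i ⟨0, hi⟩ = a := by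
  let _ : TopologicalSpace G := ⊥
  have : DiscreteTopology G := ⟨rfl⟩
  let e : c.bundleCore.TotalSpace := (c.bundleCore.localTriv i).toPartialEquiv.symm (γ 0, a)
  have he : (γ : C(unitInterval, X)) 0 = c.bundleCore.proj e := rfl
  refine ⟨c.sectionOfLift γ (c.isCoveringMap_bundleCore_proj.liftPath γ e he)
    (congr_fun (c.isCoveringMap_bundleCore_proj.liftPath_lifts γ e he)), ?_⟩
  show (c.bundleCore.localTriv i (c.isCoveringMap_bundleCore_proj.liftPath γ e he 0)).2 = a
  rw [c.isCoveringMap_bundleCore_proj.liftPath_zero]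
  exact congrArg Prod.snd ((c.bundleCore.localTriv i).toPartialEquiv.right_inv
    (show (γ 0, a) ∈ (c.bundleCore.localTriv i).target from
      (c.bundleCore.mem_localTriv_target i _).2 hi))

/-- Sections along homotopic paths with the same initial value have the same final value. -/
theorem SectionAlong.apply_one_eq_of_homotopic {c : CechOneCocycle (constantGroupSheaf X G)}
    {x y : X} {γ γ' : Path x y} (hγ : γ.Homotopic γ') (i j : c.cover.I) (hi : x ∈ c.cover.U i)
    (hj : y ∈ c.cover.U j) (s : c.SectionAlong γ) (s' : c.SectionAlong γ')
    (h : s.h i ⟨0, γ.source.symm ▸ hi⟩ = s'.h i ⟨0, γ'.source.symm ▸ hi⟩) :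
    s.h j ⟨1, γ.target.symm ▸ hj⟩ = s'.h j ⟨1, γ'.target.symm ▸ hj⟩ := by
  let _ : TopologicalSpace G := ⊥
  have : DiscreteTopology G := ⟨rfl⟩
  have cov := c.isCoveringMap_bundleCore_proj
  -- Both paths are lifted from one auxiliary point over `x`. Homotopy invariance holds for these
  -- lifts and passes to `s` and `s'`, which are right multiples of them by the same constant.
  let e : c.bundleCore.TotalSpace := (c.bundleCore.localTriv i).toPartialEquiv.symm (x, 1)
  have he : (γ : C(unitInterval, X)) 0 = c.bundleCore.proj e := γ.source
  have he' : (γ' : C(unitInterval, X)) 0 = c.bundleCore.proj e := γ'.source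
  let σ := c.sectionOfLift γ (cov.liftPath γ e he) (congr_fun (cov.liftPath_lifts γ e he))
  let σ' := c.sectionOfLift γ' (cov.liftPath γ' e he') (congr_fun (cov.liftPath_lifts γ' e he'))
  have h0 : σ.h i ⟨0, γ.source.symm ▸ hi⟩ = σ'.h i ⟨0, γ'.source.symm ▸ hi⟩ := by
    show (c.bundleCore.localTriv i (cov.liftPath γ e he 0)).2 =
      (c.bundleCore.localTriv i (cov.liftPath γ' e he' 0)).2
    rw [cov.liftPath_zero, cov.liftPath_zero]
  have h1 : σ.h j ⟨1, γ.target.symm ▸ hj⟩ = σ'.h j ⟨1, γ'.target.symm ▸ hj⟩ := by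
    show (c.bundleCore.localTriv j (cov.liftPath γ e he 1)).2 =
      (c.bundleCore.localTriv j (cov.liftPath γ' e he' 1)).2
    exact congrArg (fun p => (c.bundleCore.localTriv j p).2)
      (cov.liftPath_apply_one_eq_of_homotopicRel hγ e he he')
  obtain ⟨g, hg⟩ := s.exists_eq_mul σ
  obtain ⟨g', hg'⟩ := s'.exists_eq_mul σ'
  rw [hg, hg', h0, mul_right_inj] at h
  rw [hg, hg', h1, h]

/-! ### Transport along paths -/

theorem val_congr (c : CechOneCocycle (constantGroupSheaf X G)) (i j : c.cover.I) {y z : X}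
    (h : y = z) (hi : y ∈ c.cover.U i) (hj : y ∈ c.cover.U j) :
    c.val i j y hi hj = c.val i j z (h ▸ hi) (h ▸ hj) := by
  subst h
  rfl

theorem SectionAlong.h_congr {c : CechOneCocycle (constantGroupSheaf X G)} {x y : X} {γ : Path x y}
    (s : c.SectionAlong γ) (i : c.cover.I) {t t' : unitInterval} (h : t = t')
    (ht : γ t ∈ c.cover.U i) : s.h i ⟨t, ht⟩ = s.h i ⟨t', h ▸ ht⟩ := by
  subst h
  rfl

/-- The restriction of a section along a path to a reparametrized part of the path. -/
def SectionAlong.comp {c : CechOneCocycle (constantGroupSheaf X G)} {x y x' y' : X} {γ : Path x y}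
    (s : c.SectionAlong γ) (γ' : Path x' y') (f : C(unitInterval, unitInterval))
    (hf : ∀ t, γ' t = γ (f t)) : c.SectionAlong γ' where
  h i := (s.h i).comap ⟨fun t => ⟨f t.1, hf t.1 ▸ t.2⟩, by fun_prop⟩
  compat i j t hi hj := by
    rw [val_congr c i j (hf t) hi hj]
    exact s.compat i j (f t) (hf t ▸ hi) (hf t ▸ hj)

/-- The value at the end of the path, in the coordinates with index `j`, of the section along `γ`
which starts at `1` in the coordinates with index `i`. -/
noncomputable def transport (c : CechOneCocycle (constantGroupSheaf X G)) {x y : X} (γ : Path x y)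
    (i j : c.cover.I) (hi : x ∈ c.cover.U i) (hj : y ∈ c.cover.U j) : G :=
  (c.exists_sectionAlong γ i (γ.source.symm ▸ hi) 1).choose.h j ⟨1, γ.target.symm ▸ hj⟩

theorem SectionAlong.apply_one {c : CechOneCocycle (constantGroupSheaf X G)} {x y : X}
    {γ : Path x y} (s : c.SectionAlong γ) (i j : c.cover.I) (hi : x ∈ c.cover.U i)
    (hj : y ∈ c.cover.U j) :
    s.h j ⟨1, γ.target.symm ▸ hj⟩ =
      c.transport γ i j hi hj * s.h i ⟨0, γ.source.symm ▸ hi⟩ := by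
  have h := (c.exists_sectionAlong γ i (γ.source.symm ▸ hi) 1).choose_spec
  obtain ⟨g, hg⟩ := s.exists_eq_mul (c.exists_sectionAlong γ i (γ.source.symm ▸ hi) 1).choose
  rw [hg, hg, h, one_mul, transport]

theorem transport_eq_of_homotopic (c : CechOneCocycle (constantGroupSheaf X G)) {x y : X}
    {γ γ' : Path x y} (h : γ.Homotopic γ') (i j : c.cover.I) (hi : x ∈ c.cover.U i)
    (hj : y ∈ c.cover.U j) : c.transport γ i j hi hj = c.transport γ' i j hi hj := by
  obtain ⟨s, hs⟩ := c.exists_sectionAlong γ i (γ.source.symm ▸ hi) 1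
  obtain ⟨s', hs'⟩ := c.exists_sectionAlong γ' i (γ'.source.symm ▸ hi) 1
  have h1 := SectionAlong.apply_one_eq_of_homotopic h i j hi hj s s' (hs.trans hs'.symm)
  rwa [s.apply_one i j hi hj, s'.apply_one i j hi hj, hs, hs', mul_one, mul_one] at h1

/-- A section along the concatenation restricts to sections along both halves that agree at the
midpoint. Transport multiplies on the left, so the later path gives the left factor; this is why the
product in the fundamental group is opposite to concatenation. -/
theorem transport_trans (c : CechOneCocycle (constantGroupSheaf X G)) {x y z : X} (γ : Path x y)
    (δ : Path y z) (i j k : c.cover.I) (hi : x ∈ c.cover.U i) (hj : y ∈ c.cover.U j)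
    (hk : z ∈ c.cover.U k) :
    c.transport (γ.trans δ) i k hi hk = c.transport δ j k hj hk * c.transport γ i j hi hj := by
  obtain ⟨s, hs⟩ := c.exists_sectionAlong (γ.trans δ) i ((γ.trans δ).source.symm ▸ hi) 1
  let f₁ : C(unitInterval, unitInterval) :=
    ⟨fun t => ⟨(t : ℝ) / 2, by linarith [t.2.1], by linarith [t.2.2]⟩, by fun_prop⟩
  let f₂ : C(unitInterval, unitInterval) :=
    ⟨fun t => ⟨(1 + (t : ℝ)) / 2, by linarith [t.2.1], by linarith [t.2.2]⟩, by fun_prop⟩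
  have h₁ : ∀ t, γ t = (γ.trans δ) (f₁ t) := by
    intro t
    rw [Path.trans_apply, dif_pos (by show (t : ℝ) / 2 ≤ 1 / 2; linarith [t.2.2])]
    congr 1
    ext
    show (t : ℝ) = 2 * ((t : ℝ) / 2)
    ring
  have h₂ : ∀ t, δ t = (γ.trans δ) (f₂ t) := by
    intro t
    rw [Path.trans_apply]
    split_ifs with h
    -- At `t = 0` the midpoint belongs to the first branch of `Path.trans`, where the value is the
    -- end point of `γ`.
    · have ht : (t : ℝ) = 0 := le_antisymm
        (by change (1 + (t : ℝ)) / 2 ≤ 1 / 2 at h; linarith) t.2.1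
      obtain rfl : t = 0 := Subtype.ext ht
      rw [δ.source]
      refine γ.target.symm.trans (congrArg γ (Subtype.ext ?_))
      show (1 : ℝ) = 2 * ((1 + 0) / 2)
      norm_num
    · congr 1
      ext
      show (t : ℝ) = 2 * ((1 + (t : ℝ)) / 2) - 1
      ring
  have e₁ := (s.comp γ f₁ h₁).apply_one i j hi hj
  have e₂ := (s.comp δ f₂ h₂).apply_one j k hj hk
  have e := s.apply_one i k hi hk
  have a₀ : f₁ 0 = 0 := Subtype.ext (show (0 : ℝ) / 2 = 0 by norm_num)
  have a₁ : f₁ 1 = f₂ 0 := Subtype.ext (show (1 : ℝ) / 2 = (1 + 0) / 2 by norm_num)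
  have a₂ : f₂ 1 = 1 := Subtype.ext (show (1 + 1 : ℝ) / 2 = 1 by norm_num)
  have b₀ : (s.comp γ f₁ h₁).h i ⟨0, γ.source.symm ▸ hi⟩ = 1 := (s.h_congr i a₀ _).trans hs
  have b₁ : (s.comp γ f₁ h₁).h j ⟨1, γ.target.symm ▸ hj⟩ =
      (s.comp δ f₂ h₂).h j ⟨0, δ.source.symm ▸ hj⟩ := s.h_congr j a₁ _
  have b₂ : (s.comp δ f₂ h₂).h k ⟨1, δ.target.symm ▸ hk⟩ =
      s.h k ⟨1, (γ.trans δ).target.symm ▸ hk⟩ := s.h_congr k a₂ _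
  rw [hs, mul_one] at e
  rw [b₀, mul_one] at e₁
  rw [← b₁, e₁, b₂] at e₂
  exact e.symm.trans e₂

theorem transport_eq_one (c : CechOneCocycle (constantGroupSheaf X G)) {x y : X} (γ : Path x y)
    (i : c.cover.I) (h : ∀ t, γ t ∈ c.cover.U i) (hi : x ∈ c.cover.U i) (hj : y ∈ c.cover.U i) :
    c.transport γ i i hi hj = 1 := by
  obtain ⟨s, hs⟩ := c.exists_sectionAlong γ i (γ.source.symm ▸ hi) 1
  have e := s.apply_one i i hi hj
  have : IsLocallyConstant fun t => s.h i ⟨t, h t⟩ :=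
    (s.h i).isLocallyConstant.comp_continuous (by fun_prop)
  rw [hs, mul_one, this.apply_eq_of_preconnectedSpace 1 0, hs] at e
  exact e.symm

theorem transport_change (c : CechOneCocycle (constantGroupSheaf X G)) {x y : X} (γ : Path x y)
    (i j j' : c.cover.I) (hi : x ∈ c.cover.U i) (hj : y ∈ c.cover.U j) (hj' : y ∈ c.cover.U j') :
    c.transport γ i j' hi hj' = c.val j' j y hj' hj * c.transport γ i j hi hj := by
  obtain ⟨s, hs⟩ := c.exists_sectionAlong γ i (γ.source.symm ▸ hi) 1
  have e := s.apply_one i j hi hj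
  have e' := s.apply_one i j' hi hj'
  rw [hs, mul_one] at e e'
  rw [← e, ← e', s.compat j' j 1 (γ.target.symm ▸ hj') (γ.target.symm ▸ hj),
    val_congr c j' j γ.target]

theorem transport_refl (c : CechOneCocycle (constantGroupSheaf X G)) (x : X) (i : c.cover.I)
    (hi : x ∈ c.cover.U i) : c.transport (Path.refl x) i i hi hi = 1 :=
  c.transport_eq_one _ _ (fun _ => hi) _ _

theorem transport_symm (c : CechOneCocycle (constantGroupSheaf X G)) {x y : X} (γ : Path x y)
    (i j : c.cover.I) (hi : x ∈ c.cover.U i) (hj : y ∈ c.cover.U j) :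
    c.transport γ.symm j i hj hi = (c.transport γ i j hi hj)⁻¹ := by
  rw [eq_inv_iff_mul_eq_one, ← transport_trans, ← c.transport_refl x i hi]
  exact c.transport_eq_of_homotopic ⟨(Path.Homotopy.reflTransSymm γ).symm⟩ _ _ _ _

/-! ### Monodromy and classification up to conjugacy -/

/-- The monodromy representation of a cocycle. -/
noncomputable def monodromy (c : CechOneCocycle (constantGroupSheaf X G)) {x : X} (i : c.cover.I)
    (hi : x ∈ c.cover.U i) : FundamentalGroup X x →* G where
  toFun p := Quotient.lift (s := Path.Homotopic.setoid x x) (fun γ => c.transport γ i i hi hi)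
    (fun _ _ h => c.transport_eq_of_homotopic h i i hi hi) p
  map_one' := c.transport_refl x i hi
  map_mul' p q := by
    obtain ⟨γ, rfl⟩ := Path.Homotopic.Quotient.mk_surjective p
    obtain ⟨δ, rfl⟩ := Path.Homotopic.Quotient.mk_surjective q
    exact c.transport_trans δ γ i i i hi hi hi

theorem monodromy_mk (c : CechOneCocycle (constantGroupSheaf X G)) {x : X} (i : c.cover.I)
    (hi : x ∈ c.cover.U i) (γ : Path x x) :
    c.monodromy i hi (FundamentalGroup.fromPath (Path.Homotopic.Quotient.mk γ)) =
      c.transport γ i i hi hi :=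
  rfl

theorem isMonodromy_monodromy (c : CechOneCocycle (constantGroupSheaf X G)) {x : X}
    (i : c.cover.I) (hi : x ∈ c.cover.U i) : c.IsMonodromy i hi (c.monodromy i hi) := by
  intro γ
  obtain ⟨s, hs⟩ := c.exists_sectionAlong γ i (γ.source.symm ▸ hi) 1
  refine ⟨s, hs, ?_⟩
  rw [s.apply_one i i hi hi, hs, mul_one, monodromy_mk]

/-- Equivalent cocycles have conjugate monodromy representations. -/
theorem IsEquivalent.monodromy_conj {c c' : CechOneCocycle (constantGroupSheaf X G)}
    (h : c.IsEquivalent c') {x : X} (i : c.cover.I) (hi : x ∈ c.cover.U i) (i' : c'.cover.I)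
    (hi' : x ∈ c'.cover.U i') :
    HomModConj.mk (c.monodromy i hi) = HomModConj.mk (c'.monodromy i' hi') := by
  obtain ⟨W, r, r', A, hA⟩ := isEquivalent_iff.1 h
  obtain ⟨k, hk⟩ := W.covers x
  refine Quotient.sound (s := conjSetoid _ G) ?_
  -- The conjugating element is the change of coordinates at `x` from `i'` to `r' k`, then back
  -- through `A_k`, then from `r k` to `i`.
  refine ⟨c.val i (r.map k) x hi (r.le k hk) * (A k ⟨x, hk⟩)⁻¹ *
    c'.val (r'.map k) i' x (r'.le k hk) hi', ?_⟩
  ext p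
  obtain ⟨γ, rfl⟩ := Path.Homotopic.Quotient.mk_surjective p
  show c.transport γ i i hi hi = _ * c'.transport γ i' i' hi' hi' * _⁻¹
  obtain ⟨s, hs⟩ := c.exists_sectionAlong γ i (γ.source.symm ▸ hi) 1
  obtain ⟨s', hs'⟩ := c'.exists_sectionAlong γ i' (γ.source.symm ▸ hi') 1
  obtain ⟨g, hg⟩ := hA.exists_eq_mul s s'
  have e := s.apply_one i i hi hi
  have e' := s'.apply_one i' i' hi' hi'
  -- At time 0 the comparison of the two sections determines `g`; at time 1 it then relates the two
  -- transports.
  have h0 := hg 0 k (γ.source.symm ▸ hk)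
  have h1 := hg 1 k (γ.target.symm ▸ hk)
  have hA' : ∀ y (hy : y = x), A k ⟨y, hy.symm ▸ hk⟩ = A k ⟨x, hk⟩ := by
    rintro y rfl
    rfl
  rw [s.compat (r.map k) i 0 _ (γ.source.symm ▸ hi), s'.compat (r'.map k) i' 0 _
    (γ.source.symm ▸ hi'), hs, hs', val_congr c _ _ γ.source, val_congr c' _ _ γ.source,
    hA' _ γ.source] at h0
  rw [s.compat (r.map k) i 1 _ (γ.target.symm ▸ hi), s'.compat (r'.map k) i' 1 _
    (γ.target.symm ▸ hi'), val_congr c _ _ γ.target, val_congr c' _ _ γ.target,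
    hA' _ γ.target, e, e', hs, hs'] at h1
  rw [← c.val_inv (r.map k) i x (r.le k hk) hi]
  generalize c.val (r.map k) i x (r.le k hk) hi = a at *
  generalize c'.val (r'.map k) i' x (r'.le k hk) hi' = b at *
  generalize A k ⟨x, hk⟩ = d at *
  simp only [mul_one] at h0 h1
  obtain rfl : g = b⁻¹ * (d * a) := by rw [h0]; group
  have : c.transport γ i i hi hi = (d * a)⁻¹ * (d * (a * c.transport γ i i hi hi)) := by group
  rw [this, h1]
  group

/-- Cocycles with conjugate monodromy representations are equivalent. -/
theorem isEquivalent_of_monodromy_conj [PathConnectedSpace X] [LocallyPathConnectedSpace X]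
    {c c' : CechOneCocycle (constantGroupSheaf X G)} {x : X} (i : c.cover.I)
    (hi : x ∈ c.cover.U i) (i' : c'.cover.I) (hi' : x ∈ c'.cover.U i')
    (h : HomModConj.mk (c.monodromy i hi) = HomModConj.mk (c'.monodromy i' hi')) :
    c.IsEquivalent c' := by
  obtain ⟨g, hg⟩ := Quotient.exact (s := conjSetoid _ G) h.symm
  have hloop : ∀ γ : Path x x,
      c'.transport γ i' i' hi' hi' = g * c.transport γ i i hi hi * g⁻¹ := fun γ =>
    DFunLike.congr_fun hg (FundamentalGroup.fromPath (Path.Homotopic.Quotient.mk γ))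
  let W : OpenCovering X :=
    { I := c.cover.I × c'.cover.I
      U := fun k => c.cover.U k.1 ⊓ c'.cover.U k.2
      covers := fun y => by
        obtain ⟨j, hj⟩ := c.cover.covers y
        obtain ⟨j', hj'⟩ := c'.cover.covers y
        exact ⟨(j, j'), hj, hj'⟩ }
  let r : W.Refinement c.cover := ⟨Prod.fst, fun k => inf_le_left⟩
  let r' : W.Refinement c'.cover := ⟨Prod.snd, fun k => inf_le_right⟩
  -- The isomorphism of torsors at `y`: back along `γ` in `c`, then `g` at `x`, then forth along `γ`
  -- in `c'`.
  let B : ∀ (k : W.I) (y : X), y ∈ W.U k → Path x y → G := fun k y hy γ =>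
    c'.transport γ i' k.2 hi' hy.2 * g * (c.transport γ i k.1 hi hy.1)⁻¹
  have hB : ∀ k y hy (γ δ : Path x y), B k y hy γ = B k y hy δ := by
    intro k y hy γ δ
    have e := hloop (γ.trans δ.symm)
    rw [c.transport_trans γ δ.symm i k.1 i hi hy.1 hi, c.transport_symm δ i k.1 hi hy.1,
      c'.transport_trans γ δ.symm i' k.2 i' hi' hy.2 hi', c'.transport_symm δ i' k.2 hi' hy.2] at e
    simp only [B]
    -- The factor in parentheses is the monodromy of `c'` around `γ` followed by `δ` reversed, which
    -- `e` replaces by a conjugate of that of `c`.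
    have e₂ : c'.transport γ i' k.2 hi' hy.2 =
      c'.transport δ i' k.2 hi' hy.2 *
        ((c'.transport δ i' k.2 hi' hy.2)⁻¹ * c'.transport γ i' k.2 hi' hy.2) := by group
    rw [e₂, e]
    group
  let P : ∀ y, Path x y := PathConnectedSpace.somePath x
  have hloc : ∀ k : W.I, IsLocallyConstant fun y : W.U k => B k y y.2 (P y) := by
    intro k
    refine IsLocallyConstant.of_eventually_subtype (p := (· ∈ W.U k))
      (fun y => B k y y.2 (P y)) fun y hy => ?_
    obtain ⟨U, ⟨hU, hUp⟩, hUW⟩ := (path_connected_basis y).mem_iff.1 ((W.U k).isOpen.mem_nhds hy)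
    filter_upwards [hU] with z hz hzW
    have hj := hUp.joinedIn y (mem_of_mem_nhds hU) z hz
    have hδ : ∀ t, hj.somePath t ∈ W.U k := fun t => hUW (hj.somePath_mem t)
    show B k z hzW (P z) = B k y hy (P y)
    -- The chosen path to `z` may be replaced by the one to `y` prolonged inside `W.U k`; the
    -- prolongation has trivial transport in both cocycles.
    rw [hB k z hzW (P z) ((P y).trans hj.somePath)]
    simp only [B]
    rw [c.transport_trans _ _ i k.1 k.1 hi hy.1 hzW.1,
      c'.transport_trans _ _ i' k.2 k.2 hi' hy.2 hzW.2,
      c.transport_eq_one _ _ (fun t => (hδ t).1), c'.transport_eq_one _ _ (fun t => (hδ t).2),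
      one_mul, one_mul]
  refine isEquivalent_iff.2 ⟨W, r, r', fun k => ⟨_, hloc k⟩, fun k l y hk hl => ?_⟩
  show B k y hk (P y) * c.val k.1 l.1 y hk.1 hl.1 = c'.val k.2 l.2 y hk.2 hl.2 * B l y hl (P y)
  simp only [B]
  rw [c.transport_change (P y) i l.1 k.1 hi hl.1 hk.1,
    c'.transport_change (P y) i' l.2 k.2 hi' hl.2 hk.2]
  group

end CechOneCocycle

/-! ### Realizing a homomorphism as a monodromy representation -/

/-- In a path-connected subset all of whose loops are null-homotopic in the space, a path class
from the base point can be chosen for each point, compatibly with the paths in the subset. -/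
theorem exists_pathClass_trans_eq {X : Type u} [TopologicalSpace X] [PathConnectedSpace X] (x : X)
    {U : Set X} (hU : IsPathConnected U)
    (hl : ∀ (y : X) (γ : Path y y), (∀ t, γ t ∈ U) → γ.Homotopic (Path.refl y)) :
    ∃ σ : ∀ z, Path.Homotopic.Quotient x z, ∀ (z z' : X) (n : Path z z'), (∀ t, n t ∈ U) →
      σ z' = (σ z).trans (Path.Homotopic.Quotient.mk n) := by
  classical
  obtain ⟨y, hy, hyU⟩ := hU
  let p : Path x y := PathConnectedSpace.somePath x y
  -- Inside `U` the class goes from `x` to a fixed `y ∈ U` and then on within `U`; the value outside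
  -- `U` plays no role.
  refine ⟨fun z => if h : z ∈ U then .mk (p.trans (hyU h).somePath)
    else .mk (PathConnectedSpace.somePath x z), fun z z' n hn => ?_⟩
  have hz : z ∈ U := by simpa using hn 0
  have hz' : z' ∈ U := by simpa using hn 1
  have h := hl y (((hyU hz).somePath.trans n).trans (hyU hz').somePath.symm) (by
    intro t
    have : Set.range (((hyU hz).somePath.trans n).trans (hyU hz').somePath.symm) ⊆ U := by
      rw [Path.trans_range, Path.trans_range, Path.symm_range]
      exact Set.union_subset (Set.union_subset
        (Set.range_subset_iff.2 (hyU hz).somePath_mem) (Set.range_subset_iff.2 hn))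
        (Set.range_subset_iff.2 (hyU hz').somePath_mem)
    exact this ⟨t, rfl⟩)
  have h' := Path.Homotopic.Quotient.eq.2 h
  simp only [hz, hz', dite_true, Path.Homotopic.Quotient.mk_trans, Path.Homotopic.Quotient.mk_symm, Path.Homotopic.Quotient.mk_refl] at h' ⊢
  have h'' := congrArg (fun q => Path.Homotopic.Quotient.trans q (Path.Homotopic.Quotient.mk (hyU hz').somePath)) h'
  simp only [Path.Homotopic.Quotient.trans_assoc, Path.Homotopic.Quotient.symm_trans, Path.Homotopic.Quotient.trans_refl,
    Path.Homotopic.Quotient.refl_trans] at h''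
  rw [Path.Homotopic.Quotient.trans_assoc, h'']

instance LocallyRelativelyOneConnectedSpace.locallyPathConnectedSpace (X : Type u)
    [TopologicalSpace X] [LocallyRelativelyOneConnectedSpace X] : LocallyPathConnectedSpace X where
  path_connected_basis x := by
    refine ⟨fun N => ⟨fun hN => ?_, fun ⟨U, ⟨hU, _⟩, hUN⟩ => Filter.mem_of_superset hU hUN⟩⟩
    obtain ⟨U, hU, hUN, hUp, -⟩ := LocallyRelativelyOneConnectedSpace.exists_nhds x N hN
    exact ⟨U, ⟨hU, hUp⟩, hUN⟩

namespace CechOneCocycle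

variable {X : Type u} [TopologicalSpace X] {G : Type v} [Group G]

/-- The cocycle with given values. -/
def ofFun (W : OpenCovering X) (g : W.I → W.I → X → G)
    (hloc : ∀ i j y, y ∈ W.U i → y ∈ W.U j → ∀ᶠ z in 𝓝 y, g i j z = g i j y)
    (hmul : ∀ i j k y, y ∈ W.U i → y ∈ W.U j → y ∈ W.U k → g i j y * g j k y = g i k y) :
    CechOneCocycle (constantGroupSheaf X G) where
  cover := W
  cocycle :=
    { ev := fun i j T a b =>
        (⟨fun y : T => g i j y, IsLocallyConstant.of_eventually_subtype (p := (· ∈ T)) _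
          fun y hy => (hloc i j y (leOfHom a hy) (leOfHom b hy)).mono fun _ h _ => h⟩ :
          LocallyConstant T G)
      ev_precomp := fun _ _ _ _ _ _ _ => rfl
      ev_trans := fun i j k T a b d => LocallyConstant.ext (X := T) (Y := G) fun y =>
        hmul i j k y (leOfHom a y.2) (leOfHom b y.2) (leOfHom d y.2) }

/-- Every homomorphism from the fundamental group is conjugate to a monodromy representation. -/
theorem exists_monodromy_conj [PathConnectedSpace X] [LocallyRelativelyOneConnectedSpace X] {x : X}
    (ρ : FundamentalGroup X x →* G) :
    ∃ (c : CechOneCocycle (constantGroupSheaf X G)) (i : c.cover.I) (hi : x ∈ c.cover.U i),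
      HomModConj.mk (c.monodromy i hi) = HomModConj.mk ρ := by
  have hex : ∀ y : X, ∃ V : Opens X, y ∈ V ∧ ∃ σ : ∀ z, Path.Homotopic.Quotient x z,
      ∀ (z z' : X) (n : Path z z'), (∀ t, n t ∈ V) →
        σ z' = (σ z).trans (Path.Homotopic.Quotient.mk n) := by
    intro y
    obtain ⟨U, hU, -, hUp, hl⟩ := LocallyRelativelyOneConnectedSpace.exists_nhds y Set.univ
      Filter.univ_mem
    obtain ⟨σ, hσ⟩ := exists_pathClass_trans_eq x hUp hl
    -- The interior need not be path-connected, but the compatibility of `σ` only concerns paths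
    -- that stay in `U`, so it is inherited.
    exact ⟨⟨interior U, isOpen_interior⟩, mem_interior_iff_mem_nhds.2 hU, σ,
      fun z z' n hn => hσ z z' n fun t => interior_subset (hn t)⟩
  choose V hyV σ hσ using hex
  let W : OpenCovering X := ⟨X, V, fun y => ⟨y, hyV y⟩⟩
  -- `R a b` is `ρ` of the loop that goes out along `a` and returns along `b`. It is unchanged when
  -- `a` and `b` are prolonged by the same path (`hRt`), which yields all the local constancy below.
  let R : ∀ {z : X}, Path.Homotopic.Quotient x z → Path.Homotopic.Quotient x z → G :=
    fun a b => ρ (FundamentalGroup.fromPath (a.trans b.symm))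
  have hR : ∀ {z : X} (a b d : Path.Homotopic.Quotient x z), R b d * R a b = R a d := by
    intro z a b d
    simp only [R]
    rw [← map_mul, FundamentalGroup.mul_def]
    congr 1
    show Path.Homotopic.Quotient.trans (Path.Homotopic.Quotient.trans a b.symm) (Path.Homotopic.Quotient.trans b d.symm) = Path.Homotopic.Quotient.trans a d.symm
    rw [Path.Homotopic.Quotient.trans_assoc, ← Path.Homotopic.Quotient.trans_assoc b.symm, Path.Homotopic.Quotient.symm_trans,
      Path.Homotopic.Quotient.refl_trans]
  have hRt : ∀ {z z' : X} (a b : Path.Homotopic.Quotient x z) (n : Path.Homotopic.Quotient z z'),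
      R (a.trans n) (b.trans n) = R a b := by
    intro z z' a b n
    simp only [R]
    congr 1
    have hs : (b.trans n).symm = n.symm.trans b.symm := by
      obtain ⟨b, rfl⟩ := Path.Homotopic.Quotient.mk_surjective b
      obtain ⟨n, rfl⟩ := Path.Homotopic.Quotient.mk_surjective n
      exact congrArg Path.Homotopic.Quotient.mk (Path.trans_symm b n)
    show Path.Homotopic.Quotient.trans (Path.Homotopic.Quotient.trans a n) (b.trans n).symm = Path.Homotopic.Quotient.trans a b.symm
    rw [hs, Path.Homotopic.Quotient.trans_assoc, ← Path.Homotopic.Quotient.trans_assoc n, Path.Homotopic.Quotient.trans_symm,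
      Path.Homotopic.Quotient.refl_trans]
  let c : CechOneCocycle (constantGroupSheaf X G) := ofFun W (fun i j z => R (σ j z) (σ i z))
    (fun i j y hi hj => by
      obtain ⟨N, ⟨hN, hNp⟩, hNV⟩ := (path_connected_basis y).mem_iff.1
        (((V i).isOpen.inter (V j).isOpen).mem_nhds ⟨hi, hj⟩)
      filter_upwards [hN] with z hz
      have h := hNp.joinedIn y (mem_of_mem_nhds hN) z hz
      rw [hσ i y z h.somePath fun t => (hNV (h.somePath_mem t)).1,
        hσ j y z h.somePath fun t => (hNV (h.somePath_mem t)).2, hRt])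
    (fun i j k y _ _ _ => hR _ _ _)
  refine ⟨c, x, hyV x, ?_⟩
  -- The class `σ x x` at the base point need not be trivial; its loop accounts for the conjugation.
  refine (Quotient.sound (s := conjSetoid _ G) ⟨R (.refl x) (σ x x), ?_⟩)
  ext p
  obtain ⟨γ, rfl⟩ := Path.Homotopic.Quotient.mk_surjective p
  have : ContractibleSpace unitInterval := (convex_Icc (0 : ℝ) 1).contractibleSpace ⟨0, by simp⟩
  have : LocallyPathConnectedSpace unitInterval := (convex_Icc (0 : ℝ) 1).locallyPathConnectedSpace
  let seg : ∀ t t' : unitInterval, Path t t' := PathConnectedSpace.somePath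
  -- `τ t` is the class of `γ` restricted to `[0, t]`. Simple connectedness of the interval makes it
  -- compatible with every path in the parameter.
  let τ : ∀ t, Path.Homotopic.Quotient x (γ t) := fun t =>
    .mk (((seg 0 t).map γ.continuous).cast γ.source.symm rfl)
  have hτ : ∀ t t' (n : Path t t'), τ t' = (τ t).trans (.mk (n.map γ.continuous)) := by
    intro t t' n
    have h := (SimplyConnectedSpace.paths_homotopic (seg 0 t') ((seg 0 t).trans n)).map
      ⟨γ, γ.continuous⟩
    refine Path.Homotopic.Quotient.eq.2 ?_
    have h' := h.pathCast γ.source.symm rfl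
    have e : ((((seg 0 t).trans n).map γ.continuous).cast γ.source.symm rfl) =
        (((seg 0 t).map γ.continuous).cast γ.source.symm rfl).trans (n.map γ.continuous) := by
      rw [Path.map_trans]
      rfl
    rw [← e]
    exact h'
  -- An explicit section along `γ`, comparing the class travelled so far with the local choice. It
  -- starts at `R (.refl x) (σ x x)` and ends at `R (.mk γ) (σ x x)`, which is the starting value
  -- times `ρ` of the class of `γ`.
  let s : c.SectionAlong γ :=
    { h := fun i =>
        { toFun := fun t => R (τ t) (σ i (γ t))
          isLocallyConstant := IsLocallyConstant.of_eventually_subtype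
            (p := fun t => γ t ∈ V i) (fun t => R (τ t) (σ i (γ t))) fun t ht => by
              obtain ⟨N, ⟨hN, hNp⟩, hNV⟩ := (path_connected_basis t).mem_iff.1
                (((V i).isOpen.preimage γ.continuous).mem_nhds ht)
              filter_upwards [hN] with t' ht' _
              have h := hNp.joinedIn t (mem_of_mem_nhds hN) t' ht'
              show R (τ t') (σ i (γ t')) = R (τ t) (σ i (γ t))
              rw [hτ t t' h.somePath, hσ i (γ t) (γ t') (h.somePath.map γ.continuous)
                fun u => hNV (h.somePath_mem u), hRt] }
      compat := fun i j t _ _ => (hR (τ t) (σ j (γ t)) (σ i (γ t))).symm }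
  have e := s.apply_one x x (hyV x) (hyV x)
  have hcast : ∀ (z : X) (hz : x = z) (q : Path.Homotopic.Quotient x z),
      R q (σ x z) = R (q.cast rfl hz) (σ x x) := by
    rintro z rfl q
    rw [Path.Homotopic.Quotient.cast_rfl_rfl]
  have e₀ : s.h x ⟨0, γ.source.symm ▸ hyV x⟩ = R (.refl x) (σ x x) := by
    refine (hcast (γ 0) γ.source.symm (τ 0)).trans ?_
    congr 1
    refine Path.Homotopic.Quotient.eq.2 ?_
    refine (((SimplyConnectedSpace.paths_homotopic (seg 0 0) (Path.refl 0)).map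
      ⟨γ, γ.continuous⟩).pathCast γ.source.symm γ.source.symm).trans ?_
    convert! Path.Homotopic.refl (Path.refl x) using 1
    ext t
    exact γ.source
  have e₁ : s.h x ⟨1, γ.target.symm ▸ hyV x⟩ = R (.mk γ) (σ x x) := by
    refine (hcast (γ 1) γ.target.symm (τ 1)).trans ?_
    congr 1
    refine Path.Homotopic.Quotient.eq.2 ?_
    let ι : Path (0 : unitInterval) 1 := ⟨⟨id, continuous_id⟩, rfl, rfl⟩
    exact ((SimplyConnectedSpace.paths_homotopic (seg 0 1) ι).map
      ⟨γ, γ.continuous⟩).pathCast γ.source.symm γ.target.symm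
  rw [e₀, e₁, ← hR (.mk γ) (.refl x) (σ x x)] at e
  have e₂ : R (.mk γ) (.refl x) =
      ρ (FundamentalGroup.fromPath (Path.Homotopic.Quotient.mk γ)) := by
    simp only [R]
    congr 1
    show Path.Homotopic.Quotient.trans (Path.Homotopic.Quotient.mk γ) (Path.Homotopic.Quotient.refl x).symm = Path.Homotopic.Quotient.mk γ
    exact Path.Homotopic.Quotient.trans_refl _
  rw [e₂] at e
  exact eq_mul_inv_of_mul_eq e.symm

theorem transport_trivial {x y : X} (γ : Path x y) :
    (trivial (constantGroupSheaf X G)).transport γ PUnit.unit PUnit.unit (Set.mem_univ x)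
      (Set.mem_univ y) = 1 :=
  transport_eq_one (trivial (constantGroupSheaf X G)) γ PUnit.unit (fun _ => Set.mem_univ _) _ _

end CechOneCocycle

/-! ### The bijection -/

theorem mainTheorem8 (X : Type u) [TopologicalSpace X] [ConnectedSpace X]
    [LocallyRelativelyOneConnectedSpace X] (x : X) (G : Type v) [Group G] :
    ∃ Φ : CechH1 (constantGroupSheaf X G) ≃ HomModConj (FundamentalGroup X x) G,
      Φ (CechOneCocycle.trivial (constantGroupSheaf X G)).toH1 = HomModConj.mk 1 ∧
      ∀ (c : CechOneCocycle (constantGroupSheaf X G)) (i : c.cover.I) (hi : x ∈ c.cover.U i),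
        ∃ ρ : FundamentalGroup X x →* G, c.IsMonodromy i hi ρ ∧ Φ c.toH1 = HomModConj.mk ρ := by
  have : PathConnectedSpace X := pathConnectedSpace_iff_connectedSpace.2 inferInstance
  let f : CechH1 (constantGroupSheaf X G) → HomModConj (FundamentalGroup X x) G :=
    Quot.lift (fun c => HomModConj.mk (c.monodromy _ (c.cover.covers x).choose_spec))
      fun c c' h => h.monodromy_conj _ _ _ _
  -- A cocycle is equivalent to itself, so invariance under equivalence also shows that the orbit
  -- does not depend on the index chosen at `x`.
  have hf : ∀ (c : CechOneCocycle (constantGroupSheaf X G)) (i : c.cover.I)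
      (hi : x ∈ c.cover.U i), f c.toH1 = HomModConj.mk (c.monodromy i hi) := fun c i hi =>
    (CechOneCocycle.IsEquivalent.refl c).monodromy_conj _ _ i hi
  have hbij : Function.Bijective f := by
    constructor
    · rintro ⟨c⟩ ⟨c'⟩ h
      exact Quot.sound (CechOneCocycle.isEquivalent_of_monodromy_conj _ _ _ _ h)
    · intro q
      obtain ⟨ρ, rfl⟩ := Quotient.exists_rep q
      obtain ⟨c, i, hi, h⟩ := CechOneCocycle.exists_monodromy_conj ρ
      exact ⟨c.toH1, (hf c i hi).trans h⟩
  refine ⟨Equiv.ofBijective f hbij, ?_, fun c i hi =>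
    ⟨c.monodromy i hi, c.isMonodromy_monodromy i hi, hf c i hi⟩⟩
  refine (hf (CechOneCocycle.trivial _) PUnit.unit (Set.mem_univ x)).trans ?_
  congr 1
  ext p
  obtain ⟨γ, rfl⟩ := Path.Homotopic.Quotient.mk_surjective p
  exact CechOneCocycle.transport_trivial γ
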